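/- There exist absolute constants $D_0,D_1>0$ and, for every $q\in(1,2)$, a constant $C_q>0$ depending only on $q$, such that the following holds. Let $1<q<2$, let $m\ge 1$, $n\ge 2$ and $s\ge 1$ be integers, and let $u\ge 1$ and $F$ be real numbers. Let $A\in\mathbb{R}^{m\times n}$ be a random matrix whose rows are independent, isotropic, sub-Gaussian random vectors in $\mathbb{R}^n$ with sub-Gaussian norms at most $F$. Here a random vector $x$ is isotropic if $\mathbb{E}[xx^T]=I_n$; for a real random variable $X$ we put $\|X\|_{\psi_2}=\inf\{t>0:\mathbb{E}\exp(|X|^2/t^2)\le 2\}$; $x$ is sub-Gaussian if $\|\langle g,x\rangle\|_{\psi_2}<\infty$ for every $g\in\mathbb{R}^n$, and its sub-Gaussian norm is $\|x\|_{\psi_2}=\sup_{\|g\|_2=1}\|\langle g,x\rangle\|_{\psi_2}$. If $$C_q s\le n\qquad\text{and}\qquad m\ge D_0F^4C_q\,s\log\left(\frac{en}{s}\right)+D_1F^4u^2,$$ then, with probability at least $1-2e^{-u^2}$, $$\inf_{h\in\ker(A)\setminus\{0\}}\frac{\|h\|_1}{\|h\|_q}>3\,s^{1-1/q},$$ where $\|h\|_p=\left(\sum_{i=1}^n|h_i|^p\right)^{1/p}$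 and the infimum is $+\infty$ if $\ker(A)=\{0\}$. -/

import Mathlib

open MeasureTheory ProbabilityTheory
open scoped ENNReal Matrix

namespace NormRatio

/-- The `ℓ_p` (quasi-)norm `(∑ |h i| ^ p) ^ (1 / p)` on `ℝⁿ`, for `0 < p < ∞`. -/
noncomputable def ellNorm {n : ℕ} (p : ℝ) (h : Fin n → ℝ) : ℝ :=
  (∑ i, |h i| ^ p) ^ (1 / p)

/-- The infimum of `‖h‖_p / ‖h‖_q` over the nonzero vectors `h` of the null space of `A`.
It is taken in the extended reals, so that it is `+∞` when the null space is trivial. -/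
noncomputable def nullSpaceRatio {m n : ℕ} (p q : ℝ) (A : Matrix (Fin m) (Fin n) ℝ) : EReal :=
  ⨅ h ∈ {h : Fin n → ℝ | A *ᵥ h = 0 ∧ h ≠ 0}, ((ellNorm p h / ellNorm q h : ℝ) : EReal)

variable {Ω : Type*} [MeasurableSpace Ω]

/-- The sub-Gaussian Orlicz norm `inf {t > 0 : 𝔼 exp (|X|² / t²) ≤ 2}` of a real random variable;
it is `∞` when there is no such `t`. -/
noncomputable def psiTwoNorm (P : Measure Ω) (X : Ω → ℝ) : ℝ≥0∞ :=
  ⨅ t ∈ {t : ℝ | 0 < t ∧ ∫⁻ ω, ENNReal.ofReal (Real.exp (|X ω| ^ 2 / t ^ 2)) ∂P ≤ 2},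
    ENNReal.ofReal t

/-- A random vector is sub-Gaussian if all its linear functionals have finite Orlicz norm. -/
def IsSubGaussianVector {n : ℕ} (P : Measure Ω) (x : Ω → EuclideanSpace ℝ (Fin n)) : Prop :=
  ∀ g : EuclideanSpace ℝ (Fin n), psiTwoNorm P (fun ω => inner ℝ g (x ω)) < ∞

/-- The sub-Gaussian norm of a random vector: the supremum of the Orlicz norms of its
functionals `⟨g, x⟩` over the Euclidean unit vectors `g`. -/
noncomputable def psiTwoNormVec {n : ℕ} (P : Measure Ω) (x : Ω → EuclideanSpace ℝ (Fin n)) :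
    ℝ≥0∞ :=
  ⨆ g ∈ {g : EuclideanSpace ℝ (Fin n) | ‖g‖ = 1}, psiTwoNorm P (fun ω => inner ℝ g (x ω))

/-- A random vector is isotropic if its second-moment matrix `𝔼[x xᵀ]` exists and is the
identity matrix. -/
def IsIsotropic {n : ℕ} (P : Measure Ω) (x : Ω → EuclideanSpace ℝ (Fin n)) : Prop :=
  ∀ j k, Integrable (fun ω => x ω j * x ω k) P ∧
    ∫ ω, x ω j * x ω k ∂P = (1 : Matrix (Fin n) (Fin n) ℝ) j k

/-- The `i`-th row of a matrix, as a vector of Euclidean space. -/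
def row {m n : ℕ} (A : Matrix (Fin m) (Fin n) ℝ) (i : Fin m) : EuclideanSpace ℝ (Fin n) :=
  WithLp.toLp 2 (A i)

/-- `A` is a random matrix with independent, isotropic, sub-Gaussian rows whose sub-Gaussian
norms are all at most `F`. -/
structure IsSubGaussianMatrix {m n : ℕ} (P : Measure Ω) (F : ℝ)
    (A : Ω → Matrix (Fin m) (Fin n) ℝ) : Prop where
  measurable : ∀ i, Measurable (fun ω => row (A ω) i)
  indep : iIndepFun (fun i ω => row (A ω) i) P
  isotropic : ∀ i, IsIsotropic P (fun ω => row (A ω) i)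
  subGaussian : ∀ i, IsSubGaussianVector P (fun ω => row (A ω) i)
  norm_le : ∀ i, psiTwoNormVec P (fun ω => row (A ω) i) ≤ ENNReal.ofReal F

end NormRatio

namespace NormRatio

/-! A kernel vector with small ratio is nearly sparse, and `A` does not kill such vectors. Hölder
interpolation of ℓ_q between ℓ₁ and ℓ₂ turns `‖h‖₁ < 4 s^(1-1/q) ‖h‖_q` into `‖h‖₁² < k ‖h‖₂²`, with
`k` the product of `s` and the ceiling of `4^(q/(q-1))` (`sq_sum_abs_lt_of_ellNorm_lt`).

The opposite inequality comes from Maurey's empirical method (`le_sq_sum_abs_of_mulVec_eq_zero`).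
The vector `h/‖h‖₁` is a convex combination of signed basis vectors. If `‖Az‖² ≥ (m/2)‖z‖²` for all
sums `z` of `4k` of them, averaging over random draws passes this bound to `h`, with an error
controlled by `‖A e_j‖² ≤ 3m/2`. No net and no uniform estimate over sparse vectors is needed.

Only finitely many vectors are tested: at most `exp(6k log(en/k))` sums and `n` basis vectors.
Bernstein's inequality for `∑ (⟨g, row⟩² - 1)` bounds each failure probability by `exp(-m/(49152
F⁴))`, and a union bound finishes. -/

/-! ### Elementary exponential and counting bounds. -/

theorem exp_le_one_add_add_sq_mul_exp_abs (x : ℝ) :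
    Real.exp x ≤ 1 + x + x ^ 2 * Real.exp |x| := by
  have h := Complex.norm_exp_sub_sum_le_norm_mul_exp (x : ℂ) 2
  have e : Complex.exp x - ∑ m ∈ Finset.range 2, (x : ℂ) ^ m / (m.factorial : ℂ)
      = ((Real.exp x - (1 + x) : ℝ) : ℂ) := by
    simp [Finset.sum_range_succ]
  rw [e, Complex.norm_real, Complex.norm_real, Real.norm_eq_abs, Real.norm_eq_abs, sq_abs] at h
  linarith [le_abs_self (Real.exp x - (1 + x))]

theorem multichoose_le_exp {n k : ℕ} (hk : 1 ≤ k) (hkn : k ≤ n) :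
    ((2 * n).multichoose (4 * k) : ℝ) ≤ Real.exp (6 * k * Real.log (Real.exp 1 * n / k)) := by
  have hk0 : (0 : ℝ) < k := by exact_mod_cast hk
  have hkn' : (k : ℝ) ≤ n := by exact_mod_cast hkn
  have hn0 : (0 : ℝ) < n := hk0.trans_le hkn'
  have h1 : ((2 * n).multichoose (4 * k) : ℝ) ≤ (6 * n : ℝ) ^ (4 * k) / (4 * k).factorial := by
    rw [Nat.multichoose_eq]
    refine (Nat.choose_le_pow_div _ _).trans ?_
    gcongr
    have : 2 * n + 4 * k - 1 ≤ 6 * n := by omega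
    exact_mod_cast this
  have h2 : (6 * n : ℝ) ^ (4 * k) / (4 * k).factorial
      = (6 * n / (4 * k) : ℝ) ^ (4 * k) * ((4 * k : ℝ) ^ (4 * k) / (4 * k).factorial) := by
    rw [div_pow]; field_simp
  have h3 : (4 * k : ℝ) ^ (4 * k) / (4 * k).factorial ≤ Real.exp (4 * k) :=
    Real.pow_div_factorial_le_exp _ (by positivity) _
  have hlog : Real.log (Real.exp 1 * n / k) = 1 + Real.log (n / k) := by
    rw [mul_div_assoc, Real.log_mul (by positivity) (by positivity), Real.log_exp]
  have hlog0 : 0 ≤ Real.log (n / k) := Real.log_nonneg (by rwa [le_div_iff₀ hk0, one_mul])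
  -- The total exponent is `4k(1/2 + log(n/k)) + 4k = 6k + 4k log(n/k)`, whence the constant 6.
  have h4 : Real.log (6 * n / (4 * k)) ≤ 1 / 2 + Real.log (n / k) := by
    rw [show (6 * n / (4 * k) : ℝ) = (3 / 2) * (n / k) by field_simp; norm_num,
      Real.log_mul (by norm_num) (by positivity)]
    linarith [Real.log_le_sub_one_of_pos (show (0 : ℝ) < 3 / 2 by norm_num)]
  have h5 : (6 * n / (4 * k) : ℝ) ^ (4 * k) ≤ Real.exp (4 * k * (1 / 2 + Real.log (n / k))) := by
    rw [← Real.log_le_iff_le_exp (by positivity), Real.log_pow]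
    push_cast
    gcongr
  calc ((2 * n).multichoose (4 * k) : ℝ)
      ≤ Real.exp (4 * k * (1 / 2 + Real.log (n / k))) * Real.exp (4 * k) := by
        rw [h2] at h1
        exact h1.trans (by gcongr)
    _ ≤ _ := by
        rw [← Real.exp_add, Real.exp_le_exp, hlog]
        nlinarith [mul_nonneg hk0.le hlog0]

theorem natCast_le_exp_mul_log {n k : ℕ} (hk : 1 ≤ k) (hkn : k ≤ n) :
    (n : ℝ) ≤ Real.exp (k * Real.log (Real.exp 1 * n / k)) := by
  have hk0 : (0 : ℝ) < k := by exact_mod_cast hk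
  have hk1 : (1 : ℝ) ≤ k := by exact_mod_cast hk
  have hkn' : (k : ℝ) ≤ n := by exact_mod_cast hkn
  have hn0 : (0 : ℝ) < n := hk0.trans_le hkn'
  rw [← Real.log_le_iff_le_exp hn0, mul_div_assoc, Real.log_mul (by positivity) (by positivity),
    Real.log_exp]
  have hlog0 : 0 ≤ Real.log (n / k) := Real.log_nonneg (by rwa [le_div_iff₀ hk0, one_mul])
  have h1 : Real.log n = Real.log k + Real.log (n / k) := by
    rw [← Real.log_mul (by positivity) (by positivity)]; congr 1; field_simp
  nlinarith [Real.log_le_sub_one_of_pos hk0]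

/-! ### Maurey's empirical method. -/

/-- The right side is the `p`-average of `Q (y + v i)`: the polar form is linear, so only the
variance term is left over. Some value is at most the average; `Q` may be indefinite. -/
theorem exists_quadratic_add_le {ι V : Type*} [Fintype ι] [AddCommGroup V] [Module ℝ V]
    (Q : QuadraticMap ℝ V ℝ) {p : ι → ℝ} (hp : ∀ i, 0 ≤ p i) (hsum : ∑ i, p i = 1)
    (v : ι → V) (y : V) :
    ∃ i, Q (y + v i) ≤ Q (y + ∑ i, p i • v i) +
      (∑ i, p i * Q (v i) - Q (∑ i, p i • v i)) := by
  set c := Q (y + ∑ i, p i • v i) + (∑ i, p i * Q (v i) - Q (∑ i, p i • v i)) with hc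
  have key : ∑ i, p i * Q (y + v i) = c := by
    have h1 : QuadraticMap.polar Q y (∑ i, p i • v i) = ∑ i, p i * QuadraticMap.polar Q y (v i) := by
      rw [← QuadraticMap.polarBilin_apply_apply, map_sum]
      simp
    have h2 : ∀ x, Q (y + x) = Q y + Q x + QuadraticMap.polar Q y x := QuadraticMap.map_add Q y
    rw [hc, h2, h1]
    simp only [h2, mul_add, Finset.sum_add_distrib, ← Finset.sum_mul, hsum]
    ring
  by_contra! hlt
  obtain ⟨i, hi⟩ : ∃ i, 0 < p i := by
    by_contra! h
    have := Finset.sum_nonpos fun i (_ : i ∈ Finset.univ) => h i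
    linarith
  have : ∑ i, p i * c < ∑ i, p i * Q (y + v i) :=
    Finset.sum_lt_sum (fun j _ => mul_le_mul_of_nonneg_left (hlt j).le (hp j))
      ⟨i, Finset.mem_univ _, mul_lt_mul_of_pos_left (hlt i) hi⟩
  rw [← Finset.sum_mul, hsum, one_mul, key] at this
  exact lt_irrefl _ this

/-- Maurey's empirical method for a quadratic form: some sum of `t` of the vectors `v i` does as
well as the average over independent draws with distribution `p`. -/
theorem exists_sym_quadratic_le {ι V : Type*} [Fintype ι] [AddCommGroup V] [Module ℝ V]
    (Q : QuadraticMap ℝ V ℝ) {p : ι → ℝ} (hp : ∀ i, 0 ≤ p i) (hsum : ∑ i, p i = 1)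
    (v : ι → V) (t : ℕ) (w : V) :
    ∃ M : Sym ι t, Q (w + ((M : Multiset ι).map v).sum) ≤ Q (w + (t : ℝ) • ∑ i, p i • v i) +
      t * (∑ i, p i * Q (v i) - Q (∑ i, p i • v i)) := by
  induction t generalizing w with
  | zero => exact ⟨Sym.nil, by simp⟩
  | succ t ih =>
    -- Derandomization: one draw is fixed while the other `t` stay at their mean, at the cost of one
    -- variance term.
    obtain ⟨i, hi⟩ := exists_quadratic_add_le Q hp hsum v (w + (t : ℝ) • ∑ i, p i • v i)
    obtain ⟨M, hM⟩ := ih (w + v i)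
    refine ⟨i ::ₛ M, ?_⟩
    rw [Sym.coe_cons, Multiset.map_cons, Multiset.sum_cons, ← add_assoc]
    rw [add_right_comm w (v i) ((t : ℝ) • _)] at hM
    have e : w + (t : ℝ) • ∑ i, p i • v i + ∑ i, p i • v i
        = w + ((t + 1 : ℕ) : ℝ) • ∑ i, p i • v i := by push_cast; module
    rw [e] at hi
    push_cast at hi ⊢
    linarith

/-! ### Interpolation between norms. -/

/-- Hölder gives `‖h‖_q^q ≤ ‖h‖₁^(2-q) ‖h‖₂^(2(q-1))`. Inserted into the `q`-th power of the
hypothesis, it leaves `‖h‖₁^(2(q-1))` on the left; taking the `(q-1)`-th root produces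
`4^(q/(q-1))`. -/
theorem sq_sum_abs_lt_of_ellNorm_lt {n : ℕ} {q s : ℝ} (hq1 : 1 < q) (hq2 : q < 2) (hs : 0 < s)
    {h : Fin n → ℝ} (hlt : ellNorm 1 h < 4 * s ^ (1 - 1 / q) * ellNorm q h) :
    (∑ i, |h i|) ^ 2 < (4 : ℝ) ^ (q / (q - 1)) * s * ∑ i, h i ^ 2 := by
  have hq0 : 0 < q := by linarith
  set N := ∑ i, |h i| with hN
  set S := ∑ i, |h i| ^ q with hS
  set E := ∑ i, h i ^ 2 with hE
  have hN0 : 0 ≤ N := Finset.sum_nonneg fun _ _ => abs_nonneg _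
  have hS0 : 0 ≤ S := Finset.sum_nonneg fun _ _ => by positivity
  have hE0 : 0 ≤ E := Finset.sum_nonneg fun _ _ => sq_nonneg _
  have hlt' : N < 4 * s ^ (1 - 1 / q) * S ^ (1 / q) := by
    simpa [ellNorm, ← hN, ← hS] using hlt
  have hSpos : 0 < S := by
    rcases hS0.eq_or_lt with h0 | h0
    · rw [← h0, Real.zero_rpow (by positivity)] at hlt'
      linarith
    · exact h0
  have holder : S ≤ N ^ (2 - q) * E ^ (q - 1) := by
    have hpq : (1 / (2 - q)).HolderConjugate (1 / (q - 1)) := by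
      rw [Real.holderConjugate_iff]
      constructor
      · rw [lt_div_iff₀ (by linarith)]; linarith
      · simp
        ring
    have := Real.inner_le_Lp_mul_Lq_of_nonneg Finset.univ hpq
      (f := fun i => |h i| ^ (2 - q)) (g := fun i => (h i ^ 2) ^ (q - 1))
      (fun _ _ => by positivity) (fun _ _ => by positivity)
    have e1 : ∀ i, |h i| ^ (2 - q) * (h i ^ 2) ^ (q - 1) = |h i| ^ q := fun i => by
      rw [← sq_abs, ← Real.rpow_natCast_mul (abs_nonneg _),
        ← Real.rpow_add' (abs_nonneg _) (by push_cast; linarith)]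
      congr 1; push_cast; ring
    have e2 : ∀ i, (|h i| ^ (2 - q)) ^ (1 / (2 - q)) = |h i| := fun i => by
      rw [one_div, Real.rpow_rpow_inv (abs_nonneg _) (by linarith)]
    have e3 : ∀ i, ((h i ^ 2) ^ (q - 1)) ^ (1 / (q - 1)) = h i ^ 2 := fun i => by
      rw [one_div, Real.rpow_rpow_inv (sq_nonneg _) (by linarith)]
    simpa only [e1, e2, e3, one_div_one_div] using this
  have hNpos : 0 < N := by
    rcases hN0.eq_or_lt with h0 | h0
    · rw [← h0, Real.zero_rpow (by linarith)] at holder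
      linarith
    · exact h0
  have hEpos : 0 < E := by
    rcases hE0.eq_or_lt with h0 | h0
    · rw [← h0, Real.zero_rpow (by linarith)] at holder
      linarith
    · exact h0
  have l1 : Real.log N < Real.log 4 + (1 - 1 / q) * Real.log s + 1 / q * Real.log S := by
    have := Real.log_lt_log hNpos hlt'
    rwa [Real.log_mul (by positivity) (by positivity), Real.log_mul (by norm_num) (by positivity),
      Real.log_rpow hs, Real.log_rpow hSpos] at this
  have l2 : Real.log S ≤ (2 - q) * Real.log N + (q - 1) * Real.log E := by
    have := Real.log_le_log hSpos holder
    rwa [Real.log_mul (by positivity) (by positivity), Real.log_rpow hNpos,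
      Real.log_rpow hEpos] at this
  rw [← Real.log_lt_log_iff (by positivity) (by positivity), Real.log_pow,
    Real.log_mul (by positivity) (by positivity), Real.log_mul (by positivity) (by positivity),
    Real.log_rpow (by norm_num)]
  have l3 : q * Real.log N < q * Real.log 4 + (q - 1) * Real.log s + Real.log S := by
    have := mul_lt_mul_of_pos_left l1 hq0
    have e : q * (Real.log 4 + (1 - 1 / q) * Real.log s + 1 / q * Real.log S)
      = q * Real.log 4 + (q - 1) * Real.log s + Real.log S := by field_simp
    linarith
  have hq' : 0 < q - 1 := by linarith
  refine lt_of_mul_lt_mul_left ?_ hq'.le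
  have e : (q - 1) * (q / (q - 1) * Real.log 4 + Real.log s + Real.log E)
    = q * Real.log 4 + (q - 1) * Real.log s + (q - 1) * Real.log E := by field_simp
  rw [e]
  push_cast
  linarith

/-! ### Lower ℓ₁/ℓ₂ bound on the kernel. -/

/-- The vectors `e_j` and `-e_j`. -/
def signedBasis {n : ℕ} (a : Fin n × Bool) : Fin n → ℝ :=
  Pi.single a.1 (if a.2 then 1 else -1)

/-- The quadratic form `‖A z‖² - c ‖z‖²`. -/
noncomputable def gapForm {m n : ℕ} (A : Matrix (Fin m) (Fin n) ℝ) (c : ℝ) :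
    QuadraticMap ℝ (Fin n → ℝ) ℝ :=
  ∑ i, QuadraticMap.sq.comp (LinearMap.proj i ∘ₗ A.mulVecLin) -
    c • ∑ j, QuadraticMap.sq.comp (LinearMap.proj j)

theorem gapForm_apply {m n : ℕ} (A : Matrix (Fin m) (Fin n) ℝ) (c : ℝ) (z : Fin n → ℝ) :
    gapForm A c z = ∑ i, (A *ᵥ z) i ^ 2 - c * ∑ j, z j ^ 2 := by
  simp [gapForm, QuadraticMap.sq_apply, sq]

/-- Put `x = E/N²`. The gap form is `-mx/2` at `h/N`, at most `3m/2 - m/2 = m` at signed basis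
vectors, and nonnegative at the Maurey sum. With `4k` draws this reads `0 ≤ 1 + x/2 - 2kx`, and `k ≥
1` gives `kx ≤ 1`. -/
theorem le_sq_sum_abs_of_mulVec_eq_zero {m n k : ℕ} (hm : 1 ≤ m) (hk : 1 ≤ k)
    {A : Matrix (Fin m) (Fin n) ℝ}
    (hlow : ∀ M : Sym (Fin n × Bool) (4 * k),
      (m : ℝ) / 2 * ∑ j, ((M : Multiset (Fin n × Bool)).map signedBasis).sum j ^ 2 ≤
        ∑ i, (A *ᵥ ((M : Multiset (Fin n × Bool)).map signedBasis).sum) i ^ 2)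
    (hup : ∀ j, ∑ i, (A *ᵥ Pi.single j 1) i ^ 2 ≤ 3 / 2 * (m : ℝ))
    {h : Fin n → ℝ} (hA : A *ᵥ h = 0) (h0 : h ≠ 0) :
    k * ∑ j, h j ^ 2 ≤ (∑ j, |h j|) ^ 2 := by
  set N := ∑ j, |h j| with hN
  set E := ∑ j, h j ^ 2 with hE
  have hNpos : 0 < N := by
    refine Finset.sum_pos' (fun _ _ => abs_nonneg _) ?_
    obtain ⟨j, hj⟩ := Function.ne_iff.1 h0
    exact ⟨j, Finset.mem_univ _, abs_pos.2 hj⟩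
  let v : Fin n → Fin n → ℝ := fun j => signedBasis (j, decide (0 ≤ h j))
  have hv : ∀ j, v j = (if 0 ≤ h j then (1 : ℝ) else -1) • Pi.single j (1 : ℝ) := fun j => by
    simp only [v, signedBasis, decide_eq_true_eq, ← Pi.single_smul]
    simp
  have hcomb : ∑ j, (|h j| / N) • v j = N⁻¹ • h := by
    have : ∀ j, (|h j| / N) • v j = N⁻¹ • Pi.single j (h j) := fun j => by
      rw [hv, smul_smul, ← Pi.single_smul, ← Pi.single_smul]
      congr 1
      simp only [smul_eq_mul, mul_one]
      split_ifs with hj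
      · rw [abs_of_nonneg hj]; ring
      · rw [abs_of_neg (not_le.1 hj)]; ring
    simp_rw [this]
    rw [← Finset.smul_sum, Finset.univ_sum_single]
  obtain ⟨M, hM⟩ := exists_sym_quadratic_le (gapForm A (m / 2)) (p := fun j => |h j| / N)
    (fun j => by positivity) (by rw [← Finset.sum_div, div_self hNpos.ne']) v (4 * k) 0
  have hpos : 0 ≤ gapForm A (m / 2) (0 + ((M : Multiset (Fin n)).map v).sum) := by
    have := hlow (M.map fun j => (j, decide (0 ≤ h j)))
    rw [Sym.coe_map, Multiset.map_map] at this
    rw [zero_add, gapForm_apply]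
    exact sub_nonneg.2 this
  have hQh : gapForm A (m / 2) (N⁻¹ • h) = -(m / 2 * (N⁻¹ ^ 2 * E)) := by
    rw [gapForm_apply, Matrix.mulVec_smul, hA, hE]
    simp [mul_pow, Finset.mul_sum]
  have hQv : ∀ j, gapForm A (m / 2) (v j) ≤ m := fun j => by
    have e : (if 0 ≤ h j then (1 : ℝ) else -1) * (if 0 ≤ h j then (1 : ℝ) else -1) = 1 := by
      split_ifs <;> norm_num
    rw [hv, QuadraticMap.map_smul, e, one_smul, gapForm_apply]
    have e2 : ∑ i, (Pi.single j (1 : ℝ) : Fin n → ℝ) i ^ 2 = 1 := by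
      simp [Pi.single_apply, ite_pow]
    rw [e2]
    linarith [hup j]
  have hQsum : ∑ j, |h j| / N * gapForm A (m / 2) (v j) ≤ m := by
    calc ∑ j, |h j| / N * gapForm A (m / 2) (v j) ≤ ∑ j, |h j| / N * m :=
          Finset.sum_le_sum fun j _ => mul_le_mul_of_nonneg_left (hQv j) (by positivity)
      _ = m := by rw [← Finset.sum_mul, ← Finset.sum_div, div_self hNpos.ne', one_mul]
  rw [hcomb, zero_add ((_ : ℝ) • _), QuadraticMap.map_smul _ ((4 * k : ℕ) : ℝ), hQh] at hM
  have hE' : N⁻¹ ^ 2 * E = E / N ^ 2 := by field_simp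
  rw [hE'] at hM
  push_cast at hM
  have hm0 : (0 : ℝ) < m := by exact_mod_cast hm
  have hk1 : (1 : ℝ) ≤ k := by exact_mod_cast hk
  have hx0 : 0 ≤ E / N ^ 2 := by positivity
  rw [← div_le_one (by positivity), mul_div_assoc]
  generalize E / N ^ 2 = x at hM hx0 ⊢
  rw [smul_eq_mul] at hM
  have h1 : 0 ≤ 4 * k * m * (1 + x / 2 - 2 * (k * x)) := by
    have := mul_le_mul_of_nonneg_left hQsum (show (0 : ℝ) ≤ 4 * k by positivity)
    linarith
  have h2 := nonneg_of_mul_nonneg_right h1 (by positivity)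
  nlinarith [mul_le_mul_of_nonneg_right hk1 hx0]

/-! ### Bernstein concentration for sums of squares. -/

/-- In the second-order bound for `exp`, the linear term has mean zero and the remainder is
dominated by `exp(X²/T²)`, whose mean is at most 2. Thus `192 = 16 · 2 · 3 · 2`. -/
theorem integrable_exp_and_mgf_sq_sub_one_le {Ω : Type*} [MeasurableSpace Ω] {P : Measure Ω}
    [IsProbabilityMeasure P] {X : Ω → ℝ} (hX : Measurable X) (hint : Integrable (fun ω => X ω ^ 2) P)
    (hvar : ∫ ω, X ω ^ 2 ∂P = 1) {T : ℝ} (hT : 1 ≤ T)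
    (hexp : ∫⁻ ω, ENNReal.ofReal (Real.exp (|X ω| ^ 2 / T ^ 2)) ∂P ≤ 2)
    {l : ℝ} (hl : |l| ≤ 1 / (4 * T ^ 2)) :
    Integrable (fun ω => Real.exp (l * (X ω ^ 2 - 1))) P ∧
      mgf (fun ω => X ω ^ 2 - 1) P l ≤ Real.exp (192 * l ^ 2 * T ^ 4) := by
  have hT0 : 0 < T := by linarith
  set a := 1 / T ^ 2 with ha
  have ha0 : 0 < a := by positivity
  have ha1 : a ≤ 1 := by rw [ha, div_le_one (by positivity)]; nlinarith
  have hl' : |l| ≤ a / 4 := by rw [ha]; convert hl using 1; field_simp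
  set G : Ω → ℝ := fun ω => Real.exp (a * X ω ^ 2) with hG
  have hGeq : ∀ ω, Real.exp (|X ω| ^ 2 / T ^ 2) = G ω := fun ω => by
    rw [hG, sq_abs, ha]; congr 1; ring
  simp_rw [hGeq] at hexp
  have hGm : Measurable G := by fun_prop
  have hGint : Integrable G P := by
    refine ⟨hGm.aestronglyMeasurable, ?_⟩
    rw [hasFiniteIntegral_iff_ofReal (ae_of_all _ fun ω => (Real.exp_pos _).le)]
    exact hexp.trans_lt (by simp)
  have hG2 : ∫ ω, G ω ∂P ≤ 2 := by
    rw [integral_eq_lintegral_of_nonneg_ae (ae_of_all _ fun ω => (Real.exp_pos _).le)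
      hGm.aestronglyMeasurable]
    exact ENNReal.toReal_le_of_le_ofReal (by norm_num) (by simpa using hexp)
  have hpt : ∀ ω, Real.exp (l * (X ω ^ 2 - 1)) ≤
      1 + l * (X ω ^ 2 - 1) + 96 * l ^ 2 * T ^ 4 * G ω := fun ω => by
    set W := X ω ^ 2 - 1 with hW
    have hWabs : |W| ≤ X ω ^ 2 + 1 := by
      rw [abs_le]; constructor <;> nlinarith [sq_nonneg (X ω)]
    have h1 := exp_le_one_add_add_sq_mul_exp_abs (l * W)
    have h2 : (a / 4 * |W|) ^ 2 ≤ 2 * Real.exp (a / 4 * |W|) := by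
      have := Real.quadratic_le_exp_of_nonneg (x := a / 4 * |W|) (by positivity)
      nlinarith [show 0 ≤ a / 4 * |W| by positivity]
    have h3 : Real.exp |l * W| ≤ Real.exp (a / 4 * |W|) := by
      rw [abs_mul]; gcongr
    have h4 : Real.exp (a / 4 * |W|) * Real.exp (a / 4 * |W|) ≤ 3 * G ω := by
      have e3 : Real.exp 1 ≤ 3 := Real.exp_one_lt_d9.le.trans (by norm_num)
      calc _ = Real.exp (a / 2 * |W|) := by rw [← Real.exp_add]; congr 1; ring
        _ ≤ Real.exp (1 + a * X ω ^ 2) := by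
          rw [Real.exp_le_exp]
          have := mul_le_mul_of_nonneg_left hWabs (show 0 ≤ a / 2 by positivity)
          nlinarith [mul_nonneg ha0.le (sq_nonneg (X ω))]
        _ ≤ _ := by rw [Real.exp_add]; gcongr
    have h5 : (l * W) ^ 2 = 16 * l ^ 2 * T ^ 4 * (a / 4 * |W|) ^ 2 := by
      rw [mul_pow _ |W|, sq_abs, ha]; field_simp; norm_num
    calc Real.exp (l * W) ≤ 1 + l * W + (l * W) ^ 2 * Real.exp |l * W| := h1
      _ ≤ 1 + l * W + 16 * l ^ 2 * T ^ 4 * (2 * Real.exp (a / 4 * |W|)) *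
          Real.exp (a / 4 * |W|) := by
        rw [h5]; gcongr
      _ = 1 + l * W + 32 * l ^ 2 * T ^ 4 *
          (Real.exp (a / 4 * |W|) * Real.exp (a / 4 * |W|)) := by ring
      _ ≤ 1 + l * W + 32 * l ^ 2 * T ^ 4 * (3 * G ω) := by gcongr
      _ = _ := by ring
  have hWint : Integrable (fun ω => l * (X ω ^ 2 - 1)) P :=
    (hint.sub (integrable_const 1)).const_mul l
  have hRint : Integrable (fun ω => 1 + l * (X ω ^ 2 - 1) + 96 * l ^ 2 * T ^ 4 * G ω) P :=
    ((integrable_const 1).add hWint).add (hGint.const_mul _)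
  have hLint : Integrable (fun ω => Real.exp (l * (X ω ^ 2 - 1))) P :=
    hRint.mono' (by fun_prop) (ae_of_all _ fun ω => by
      rw [Real.norm_eq_abs, Real.abs_exp]; exact hpt ω)
  refine ⟨hLint, ?_⟩
  calc mgf (fun ω => X ω ^ 2 - 1) P l
      ≤ ∫ ω, (1 + l * (X ω ^ 2 - 1) + 96 * l ^ 2 * T ^ 4 * G ω) ∂P :=
        integral_mono hLint hRint hpt
    _ = 1 + 96 * l ^ 2 * T ^ 4 * ∫ ω, G ω ∂P := by
        have h1W : Integrable (fun ω => 1 + l * (X ω ^ 2 - 1)) P := (integrable_const 1).add hWint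
        rw [integral_add h1W (hGint.const_mul _), integral_add (integrable_const 1) hWint, integral_const_mul, integral_const_mul,
          integral_sub hint (integrable_const 1), hvar]
        simp
    _ ≤ 1 + 96 * l ^ 2 * T ^ 4 * 2 := by gcongr
    _ ≤ _ := by
        have := Real.add_one_le_exp (192 * l ^ 2 * T ^ 4)
        linarith

theorem measureReal_sum_sq_tails {Ω : Type*} [MeasurableSpace Ω] {P : Measure Ω}
    [IsProbabilityMeasure P] {m : ℕ} {X : Fin m → Ω → ℝ} (hX : ∀ i, Measurable (X i))
    (hind : iIndepFun X P) (hint : ∀ i, Integrable (fun ω => X i ω ^ 2) P)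
    (hvar : ∀ i, ∫ ω, X i ω ^ 2 ∂P = 1) {T : ℝ} (hT : 1 ≤ T)
    (hexp : ∀ i, ∫⁻ ω, ENNReal.ofReal (Real.exp (|X i ω| ^ 2 / T ^ 2)) ∂P ≤ 2) :
    P.real {ω | ∑ i, X i ω ^ 2 ≤ m / 2} ≤ Real.exp (-(m / (3072 * T ^ 4))) ∧
      P.real {ω | 3 / 2 * m ≤ ∑ i, X i ω ^ 2} ≤ Real.exp (-(m / (3072 * T ^ 4))) := by
  have hT0 : 0 < T := by linarith
  set Y : Fin m → Ω → ℝ := fun i ω => X i ω ^ 2 - 1 with hY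
  have hYm : ∀ i, Measurable (Y i) := fun i => by fun_prop
  have hYind : iIndepFun Y P := hind.comp (fun _ x => x ^ 2 - 1) (fun _ => by fun_prop)
  have hsum : ∀ ω, (∑ i, Y i) ω = ∑ i, X i ω ^ 2 - m := fun ω => by
    simp [hY, Finset.sum_sub_distrib]
  -- The minimizer of the Chernoff exponent `-bm/2 + 192 m b² T⁴`; it is in the admissible range
  -- since `T ≥ 1`.
  set b := 1 / (768 * T ^ 4) with hb
  have hb0 : 0 < b := by positivity
  have hbT : b ≤ 1 / (4 * T ^ 2) := by
    rw [hb]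
    gcongr <;> norm_num
  have hmgf : ∀ l, |l| = b → Integrable (fun ω => Real.exp (l * (∑ i, Y i) ω)) P ∧
      mgf (∑ i, Y i) P l ≤ Real.exp (m * (192 * b ^ 2 * T ^ 4)) := fun l hl => by
    have h1 := fun i => integrable_exp_and_mgf_sq_sub_one_le (hX i) (hint i) (hvar i) hT (hexp i)
      (hl.le.trans hbT)
    refine ⟨hYind.integrable_exp_mul_sum hYm fun i _ => (h1 i).1, ?_⟩
    rw [hYind.mgf_sum hYm]
    calc ∏ i, mgf (Y i) P l ≤ ∏ i : Fin m, Real.exp (192 * l ^ 2 * T ^ 4) :=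
          Finset.prod_le_prod (fun _ _ => mgf_nonneg) fun i _ => (h1 i).2
      _ = _ := by
          rw [Finset.prod_const, Finset.card_univ, Fintype.card_fin, ← Real.exp_nat_mul,
            ← hl, sq_abs]
  have hexpo : -b * (m / 2) + m * (192 * b ^ 2 * T ^ 4) = -(m / (3072 * T ^ 4)) := by
    rw [hb]; field_simp; ring
  constructor
  · obtain ⟨hi, hle⟩ := hmgf (-b) (by rw [abs_neg, abs_of_pos hb0])
    have := measure_le_le_exp_mul_mgf (-(m / 2 : ℝ)) (by linarith) hi
    have e : {ω | ∑ i, X i ω ^ 2 ≤ m / 2} = {ω | (∑ i, Y i) ω ≤ -(m / 2 : ℝ)} := by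
      ext ω
      simp only [Set.mem_ofPred_eq, hsum]
      constructor <;> intro h <;> linarith
    rw [e, ← hexpo, Real.exp_add]
    refine this.trans ?_
    rw [show - -b * -(m / 2 : ℝ) = -b * (m / 2) by ring]
    gcongr
  · obtain ⟨hi, hle⟩ := hmgf b (abs_of_pos hb0)
    have := measure_ge_le_exp_mul_mgf (m / 2 : ℝ) hb0.le hi
    have e : {ω | 3 / 2 * (m : ℝ) ≤ ∑ i, X i ω ^ 2} = {ω | (m / 2 : ℝ) ≤ (∑ i, Y i) ω} := by
      ext ω
      simp only [Set.mem_ofPred_eq, hsum]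
      constructor <;> intro h <;> linarith
    rw [e, ← hexpo, Real.exp_add]
    refine this.trans ?_
    gcongr

/-! ### From Orlicz norms and isotropy to tails of `‖Az‖²`. -/

/-- By `1 + x ≤ exp x`, unit second moment forces `1 + 1/t² ≤ 2` for every admissible `t`. -/
theorem one_le_of_psiTwoNorm_le {Ω : Type*} [MeasurableSpace Ω] {P : Measure Ω}
    [IsProbabilityMeasure P] {X : Ω → ℝ} (hint : Integrable (fun ω => X ω ^ 2) P)
    (hvar : ∫ ω, X ω ^ 2 ∂P = 1) {F : ℝ} (hF : psiTwoNorm P X ≤ ENNReal.ofReal F) : 1 ≤ F := by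
  rw [← ENNReal.one_le_ofReal]
  refine le_trans (le_iInf₂ fun t ht => ?_) hF
  obtain ⟨ht0, ht⟩ := ht
  rw [ENNReal.one_le_ofReal]
  have h1 : ENNReal.ofReal (∫ ω, (1 + X ω ^ 2 / t ^ 2) ∂P) ≤ 2 := by
    refine le_trans ?_ ht
    have hi : Integrable (fun ω => 1 + X ω ^ 2 / t ^ 2) P :=
      (integrable_const 1).add (hint.div_const _)
    rw [ofReal_integral_eq_lintegral_ofReal hi
      (ae_of_all _ fun ω => by positivity)]
    refine lintegral_mono fun ω => ENNReal.ofReal_le_ofReal ?_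
    rw [sq_abs, add_comm]
    exact Real.add_one_le_exp _
  rw [integral_add (integrable_const 1) (hint.div_const _), integral_div, hvar] at h1
  have h2 : 1 + 1 / t ^ 2 ≤ 2 := by
    simpa [ENNReal.ofReal_le_ofNat] using h1
  have h3 : 1 / t ^ 2 ≤ 1 := by linarith
  rw [div_le_one (by positivity)] at h3
  nlinarith

theorem lintegral_exp_le_two_of_psiTwoNorm_lt {Ω : Type*} [MeasurableSpace Ω] {P : Measure Ω}
    {X : Ω → ℝ} {T : ℝ} (hT : psiTwoNorm P X < ENNReal.ofReal T) :
    ∫⁻ ω, ENNReal.ofReal (Real.exp (|X ω| ^ 2 / T ^ 2)) ∂P ≤ 2 := by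
  simp only [psiTwoNorm, iInf_lt_iff] at hT
  obtain ⟨t, ⟨ht0, ht⟩, htT⟩ := hT
  refine le_trans (lintegral_mono fun ω => ?_) ht
  have : t < T := (ENNReal.ofReal_lt_ofReal_iff_of_nonneg ht0.le).1 htT
  gcongr

theorem IsIsotropic.integral_inner_sq {Ω : Type*} [MeasurableSpace Ω] {P : Measure Ω} {n : ℕ}
    {x : Ω → EuclideanSpace ℝ (Fin n)} (hx : IsIsotropic P x) {g : EuclideanSpace ℝ (Fin n)}
    (hg : ‖g‖ = 1) :
    Integrable (fun ω => (inner ℝ g (x ω)) ^ 2) P ∧ ∫ ω, (inner ℝ g (x ω)) ^ 2 ∂P = 1 := by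
  have e : ∀ ω, (inner ℝ g (x ω)) ^ 2 = ∑ j, ∑ k, g j * g k * (x ω j * x ω k) := fun ω => by
    rw [PiLp.inner_apply, sq, Finset.sum_mul_sum]
    refine Finset.sum_congr rfl fun j _ => Finset.sum_congr rfl fun k _ => ?_
    simp only [RCLike.inner_apply, conj_trivial]
    ring
  have hi : ∀ j k, Integrable (fun ω => g j * g k * (x ω j * x ω k)) P :=
    fun j k => (hx j k).1.const_mul _
  simp_rw [e]
  refine ⟨integrable_finsetSum _ fun j _ => integrable_finsetSum _ fun k _ => hi j k, ?_⟩
  rw [integral_finsetSum _ fun j _ => integrable_finsetSum _ fun k _ => hi j k]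
  simp_rw [integral_finsetSum _ fun k _ => hi _ k, integral_const_mul, (hx _ _).2,
    Matrix.one_apply]
  have h2 : ∑ j, g j ^ 2 = 1 := by
    rw [← EuclideanSpace.real_norm_sq_eq, hg, one_pow]
  simpa [sq] using h2

variable {Ω : Type*} [MeasurableSpace Ω] {P : Measure Ω} {m n : ℕ} {F : ℝ}
  {A : Ω → Matrix (Fin m) (Fin n) ℝ}

theorem IsSubGaussianMatrix.psiTwoNorm_inner_le (hA : IsSubGaussianMatrix P F A) (i : Fin m)
    {g : EuclideanSpace ℝ (Fin n)} (hg : ‖g‖ = 1) :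
    psiTwoNorm P (fun ω => inner ℝ g (row (A ω) i)) ≤ ENNReal.ofReal F :=
  (le_iSup₂ (f := fun (g : EuclideanSpace ℝ (Fin n)) (_ : g ∈ {g | ‖g‖ = 1}) =>
    psiTwoNorm P (fun ω => inner ℝ g (row (A ω) i))) g hg).trans (hA.norm_le i)

theorem IsSubGaussianMatrix.one_le [IsProbabilityMeasure P] (hA : IsSubGaussianMatrix P F A) (hm : 1 ≤ m)
    (hn : 1 ≤ n) : 1 ≤ F := by
  have hg : ‖EuclideanSpace.single (⟨0, hn⟩ : Fin n) (1 : ℝ)‖ = 1 := by simp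
  obtain ⟨h1, h2⟩ := (hA.isotropic ⟨0, hm⟩).integral_inner_sq hg
  exact one_le_of_psiTwoNorm_le h1 h2 (hA.psiTwoNorm_inner_le ⟨0, hm⟩ hg)

theorem IsSubGaussianMatrix.measureReal_mulVec_tails [IsProbabilityMeasure P]
    (hA : IsSubGaussianMatrix P F A) (hF : 1 ≤ F) (z : Fin n → ℝ) :
    P.real {ω | ∑ i, (A ω *ᵥ z) i ^ 2 < m / 2 * ∑ j, z j ^ 2} ≤
        Real.exp (-(m / (49152 * F ^ 4))) ∧
      P.real {ω | 3 / 2 * m * ∑ j, z j ^ 2 < ∑ i, (A ω *ᵥ z) i ^ 2} ≤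
        Real.exp (-(m / (49152 * F ^ 4))) := by
  rcases eq_or_ne z 0 with rfl | hz
  · simp [Real.exp_nonneg]
  set w : EuclideanSpace ℝ (Fin n) := WithLp.toLp 2 z with hw
  have hw0 : w ≠ 0 := by simpa [hw] using hz
  have hwpos : 0 < ‖w‖ := norm_pos_iff.2 hw0
  have hsq : ∑ j, z j ^ 2 = ‖w‖ ^ 2 := by rw [EuclideanSpace.real_norm_sq_eq]
  set g : EuclideanSpace ℝ (Fin n) := ‖w‖⁻¹ • w with hgdef
  have hg : ‖g‖ = 1 := by rw [hgdef, norm_smul, norm_inv, norm_norm, inv_mul_cancel₀ hwpos.ne']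
  have hmul : ∀ ω i, (A ω *ᵥ z) i = ‖w‖ * inner ℝ g (row (A ω) i) := fun ω i => by
    rw [hgdef, real_inner_smul_left, mul_inv_cancel_left₀ hwpos.ne', PiLp.inner_apply]
    simp [Matrix.mulVec, dotProduct, row, hw]
  have hsum : ∀ ω, ∑ i, (A ω *ᵥ z) i ^ 2 = ‖w‖ ^ 2 * ∑ i, (inner ℝ g (row (A ω) i)) ^ 2 :=
    fun ω => by simp_rw [hmul, mul_pow, Finset.mul_sum]
  -- Doubling `F` makes the norm bound strict, so attainment of the infimum is not needed; it costs
  -- `2⁴` in the rate.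
  have hexp : ∀ i, ∫⁻ ω, ENNReal.ofReal (Real.exp (|inner ℝ g (row (A ω) i)| ^ 2 / (2 * F) ^ 2)) ∂P
      ≤ 2 := fun i => lintegral_exp_le_two_of_psiTwoNorm_lt <|
    (hA.psiTwoNorm_inner_le i hg).trans_lt <|
      (ENNReal.ofReal_lt_ofReal_iff (by linarith)).2 (by linarith)
  obtain ⟨h1, h2⟩ := measureReal_sum_sq_tails
    (X := fun i ω => inner ℝ g (row (A ω) i))
    (fun i => measurable_const.inner (hA.measurable i))
    (hA.indep.comp (fun _ x => inner ℝ g x) fun _ => by fun_prop)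
    (fun i => ((hA.isotropic i).integral_inner_sq hg).1)
    (fun i => ((hA.isotropic i).integral_inner_sq hg).2) (by linarith : 1 ≤ 2 * F) hexp
  rw [show 3072 * (2 * F) ^ 4 = 49152 * F ^ 4 by ring] at h1 h2
  have hw2 : 0 < ‖w‖ ^ 2 := by positivity
  constructor
  · refine (measureReal_mono fun ω hω => ?_).trans h1
    simp only [Set.mem_ofPred_eq, hsum, hsq] at hω ⊢
    rw [mul_comm] at hω
    exact (lt_of_mul_lt_mul_right hω hw2.le).le
  · refine (measureReal_mono fun ω hω => ?_).trans h2
    simp only [Set.mem_ofPred_eq, hsum, hsq] at hω ⊢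
    rw [mul_comm (‖w‖ ^ 2)] at hω
    exact (lt_of_mul_lt_mul_right hω hw2.le).le

/-! ### Deterministic criterion and union bound. -/

theorem lt_nullSpaceRatio {A : Matrix (Fin m) (Fin n) ℝ} {k s : ℕ} {q : ℝ} (hq1 : 1 < q)
    (hq2 : q < 2) (hs : 1 ≤ s) (hm : 1 ≤ m) (hk : 1 ≤ k)
    (hks : (4 : ℝ) ^ (q / (q - 1)) * s ≤ k)
    (hlow : ∀ M : Sym (Fin n × Bool) (4 * k),
      (m : ℝ) / 2 * ∑ j, ((M : Multiset (Fin n × Bool)).map signedBasis).sum j ^ 2 ≤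
        ∑ i, (A *ᵥ ((M : Multiset (Fin n × Bool)).map signedBasis).sum) i ^ 2)
    (hup : ∀ j, ∑ i, (A *ᵥ Pi.single j 1) i ^ 2 ≤ 3 / 2 * (m : ℝ)) :
    ((3 * (s : ℝ) ^ (1 - 1 / q) : ℝ) : EReal) < nullSpaceRatio 1 q A := by
  have hs0 : (0 : ℝ) < s := by exact_mod_cast hs
  have hr : 0 < (s : ℝ) ^ (1 - 1 / q) := by positivity
  -- Every ratio is at least the value with 4, which keeps the infimum strictly above the value with
  -- 3.
  refine lt_of_lt_of_le (b := ((4 * (s : ℝ) ^ (1 - 1 / q) : ℝ) : EReal))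
    (EReal.coe_lt_coe_iff.2 (by linarith)) (le_iInf₂ fun h hh => EReal.coe_le_coe_iff.2 ?_)
  obtain ⟨hAh, h0⟩ := hh
  by_contra! hlt
  have hpos : 0 < ellNorm q h := by
    obtain ⟨j, hj⟩ := Function.ne_iff.1 h0
    refine Real.rpow_pos_of_pos (Finset.sum_pos' (fun _ _ => by positivity)
      ⟨j, Finset.mem_univ _, Real.rpow_pos_of_pos (abs_pos.2 hj) _⟩) _
  rw [div_lt_iff₀ hpos] at hlt
  have h1 := sq_sum_abs_lt_of_ellNorm_lt hq1 hq2 hs0 hlt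
  have h2 := le_sq_sum_abs_of_mulVec_eq_zero hm hk hlow hup hAh h0
  have h3 := mul_le_mul_of_nonneg_right hks
    (Finset.sum_nonneg fun j (_ : j ∈ Finset.univ) => sq_nonneg (h j))
  linarith

end NormRatio

theorem theorem4p3 :
    ∃ (D₀ D₁ : ℝ) (C : ℝ → ℝ), 0 < D₀ ∧ 0 < D₁ ∧
      ∀ q : ℝ, 1 < q → q < 2 → 0 < C q ∧
        ∀ (Ω : Type*) [MeasurableSpace Ω] (P : Measure Ω) [IsProbabilityMeasure P]
          (m n s : ℕ) (u F : ℝ) (A : Ω → Matrix (Fin m) (Fin n) ℝ),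
          1 ≤ m → 2 ≤ n → 1 ≤ s → 1 ≤ u →
          NormRatio.IsSubGaussianMatrix P F A →
          C q * s ≤ n →
          D₀ * F ^ 4 * C q * s * Real.log (Real.exp 1 * n / s) + D₁ * F ^ 4 * u ^ 2 ≤ m →
          1 - 2 * Real.exp (-u ^ 2) ≤
            P.real {ω | ((3 * (s : ℝ) ^ (1 - 1 / q) : ℝ) : EReal) <
              NormRatio.nullSpaceRatio 1 q (A ω)} := by
  -- Here `49152 = 3072 · 2⁴` is the tail constant and `294912 = 6 · 49152` absorbs the count of
  -- sums. The ceiling makes `k = C q * s` an integer.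
  refine ⟨294912, 49152, fun q => (⌈(4 : ℝ) ^ (q / (q - 1))⌉₊ : ℝ), by norm_num, by norm_num,
    fun q hq1 hq2 => ⟨by positivity, ?_⟩⟩
  intro Ω _ P _ m n s u F A hm hn hs _ hA hCn hmle
  set κ : ℕ := ⌈(4 : ℝ) ^ (q / (q - 1))⌉₊ with hκ
  have hκ1 : 1 ≤ κ := Nat.ceil_pos.2 (by positivity)
  set k : ℕ := κ * s with hkdef
  have hk : 1 ≤ k := Nat.mul_pos hκ1 hs
  have hkn : k ≤ n := by
    have : (κ : ℝ) * s ≤ n := hCn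
    exact_mod_cast this
  have hF : 1 ≤ F := hA.one_le hm (by omega)
  have hs0 : (0 : ℝ) < s := by exact_mod_cast hs
  have hk0 : (0 : ℝ) < k := by exact_mod_cast hk
  have hn0 : (0 : ℝ) < n := by exact_mod_cast (by omega : 0 < n)
  have hks : (4 : ℝ) ^ (q / (q - 1)) * s ≤ k := by
    rw [hkdef, Nat.cast_mul]
    exact mul_le_mul_of_nonneg_right (Nat.le_ceil _) hs0.le
  set L := Real.log (Real.exp 1 * n / k) with hL
  have hL0 : 0 ≤ L := by
    refine Real.log_nonneg ((one_le_div hk0).2 ?_)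
    have : (k : ℝ) ≤ n := by exact_mod_cast hkn
    nlinarith [Real.add_one_le_exp 1]
  have hLs : L ≤ Real.log (Real.exp 1 * n / s) := by
    refine Real.log_le_log (by positivity) ?_
    gcongr
    exact Nat.le_mul_of_pos_left s hκ1
  have hrate : 6 * k * L + u ^ 2 ≤ m / (49152 * F ^ 4) := by
    rw [le_div_iff₀ (by positivity)]
    refine le_trans ?_ hmle
    have : 294912 * F ^ 4 * κ * s * L ≤
        294912 * F ^ 4 * κ * s * Real.log (Real.exp 1 * n / s) := by gcongr
    have hc : (k : ℝ) = κ * s := by rw [hkdef, Nat.cast_mul]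
    rw [hc]
    linarith
  have htail : Real.exp (-(m / (49152 * F ^ 4))) ≤
      Real.exp (-(6 * k * L)) * Real.exp (-u ^ 2) := by
    rw [← Real.exp_add, Real.exp_le_exp]
    linarith
  let z : Sym (Fin n × Bool) (4 * k) → Fin n → ℝ :=
    fun M => ((M : Multiset (Fin n × Bool)).map NormRatio.signedBasis).sum
  let bad₁ : Sym (Fin n × Bool) (4 * k) → Set Ω :=
    fun M => {ω | ∑ i, (A ω *ᵥ z M) i ^ 2 < m / 2 * ∑ j, z M j ^ 2}
  let bad₂ : Fin n → Set Ω := fun j =>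
    {ω | 3 / 2 * m * ∑ l, (Pi.single j 1 : Fin n → ℝ) l ^ 2 < ∑ i, (A ω *ᵥ Pi.single j 1) i ^ 2}
  have hb₁ : P.real (⋃ M, bad₁ M) ≤ Real.exp (-u ^ 2) := by
    calc P.real (⋃ M, bad₁ M) ≤ ∑ M, P.real (bad₁ M) := measureReal_iUnion_fintype_le _
      _ ≤ ∑ M : Sym (Fin n × Bool) (4 * k), Real.exp (-(m / (49152 * F ^ 4))) :=
        Finset.sum_le_sum fun M _ => (hA.measureReal_mulVec_tails hF _).1
      _ = ((2 * n).multichoose (4 * k) : ℝ) * Real.exp (-(m / (49152 * F ^ 4))) := by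
        rw [Finset.sum_const, Finset.card_univ, Sym.card_sym_eq_multichoose, nsmul_eq_mul]
        simp [mul_comm n]
      _ ≤ Real.exp (6 * k * L) * (Real.exp (-(6 * k * L)) * Real.exp (-u ^ 2)) := by
        gcongr
        exact NormRatio.multichoose_le_exp hk hkn
      _ = Real.exp (-u ^ 2) := by
        rw [← mul_assoc, ← Real.exp_add, add_neg_cancel, Real.exp_zero, one_mul]
  have hb₂ : P.real (⋃ j, bad₂ j) ≤ Real.exp (-u ^ 2) := by
    calc P.real (⋃ j, bad₂ j) ≤ ∑ j, P.real (bad₂ j) := measureReal_iUnion_fintype_le _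
      _ ≤ ∑ j : Fin n, Real.exp (-(m / (49152 * F ^ 4))) :=
        Finset.sum_le_sum fun j _ => (hA.measureReal_mulVec_tails hF _).2
      _ = (n : ℝ) * Real.exp (-(m / (49152 * F ^ 4))) := by simp
      _ ≤ Real.exp (6 * k * L) * (Real.exp (-(6 * k * L)) * Real.exp (-u ^ 2)) := by
        gcongr
        refine (NormRatio.natCast_le_exp_mul_log hk hkn).trans (Real.exp_le_exp.2 ?_)
        nlinarith [mul_nonneg hk0.le hL0]
      _ = Real.exp (-u ^ 2) := by
        rw [← mul_assoc, ← Real.exp_add, add_neg_cancel, Real.exp_zero, one_mul]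
  set S : Set Ω := {ω | ((3 * (s : ℝ) ^ (1 - 1 / q) : ℝ) : EReal) <
    NormRatio.nullSpaceRatio 1 q (A ω)} with hS
  -- Covering the whole space, rather than taking complements, avoids measurability of `S`.
  have hcover : Set.univ ⊆ S ∪ ((⋃ M, bad₁ M) ∪ ⋃ j, bad₂ j) := by
    intro ω _
    by_contra hω
    simp only [Set.mem_union, Set.mem_iUnion, not_or, not_exists] at hω
    obtain ⟨hωS, h1, h2⟩ := hω
    refine hωS (NormRatio.lt_nullSpaceRatio hq1 hq2 hs hm hk hks (fun M => not_lt.1 (h1 M))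
      fun j => ?_)
    have : ∑ i, (A ω *ᵥ Pi.single j 1) i ^ 2 ≤
        3 / 2 * m * ∑ l, (Pi.single j 1 : Fin n → ℝ) l ^ 2 := not_lt.1 (h2 j)
    simpa [Pi.single_apply, ite_pow] using this
  have h1 : (1 : ℝ) ≤ P.real S + (P.real (⋃ M, bad₁ M) + P.real (⋃ j, bad₂ j)) := by
    calc (1 : ℝ) = P.real Set.univ := by simp
      _ ≤ P.real (S ∪ ((⋃ M, bad₁ M) ∪ ⋃ j, bad₂ j)) := measureReal_mono hcover
      _ ≤ P.real S + P.real ((⋃ M, bad₁ M) ∪ ⋃ j, bad₂ j) := measureReal_union_le _ _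
      _ ≤ _ := by gcongr; exact measureReal_union_le _ _
  linarith
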